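/- Let $\mathcal{Q} = (E^0, E^1, r, s, \lambda)$ be a topological quiver: $E^0$ and $E^1$ are second countable locally compact Hausdorff spaces, $r : E^1 \to E^0$ is a continuous open map, $s : E^1 \to E^0$ is a continuous map, and $\lambda = \{\lambda_v\}_{v \in E^0}$ is a family of Radon measures on $E^1$ such that $\operatorname{supp} \lambda_v = r^{-1}(v)$ for all $v \in E^0$ and the function $v \mapsto \int_{E^1} \xi \, d\lambda_v$ belongs to $C_c(E^0)$ for all $\xi \in C_c(E^1)$. Let $X$ be the associated $C^*$-correspondence over $A = C_0(E^0)$: the completion of $C_c(E^1)$ in the norm $\|\xi\| = \|\langle \xi, \xi \rangle_A\|^{1/2}$ given by the $A$-valued inner product $\langle \xi, \eta \rangle_A (v) = \int_{r^{-1}(v)} \overline{\xi(\alpha)}\, \eta(\alpha)\, d\lambda_v(\alpha)$, with right action $(\xi \cdot f)(\alpha) = \xi(\alpha) f(r(\alpha))$ and left action $\phi : A \to \mathcal{L}(X)$, $(\phi(f)\xi)(\alpha) = f(s(\alpha))\, \xi(\alpha)$, for $\xi \in C_c(E^1)$ and $f \in C_0(E^0)$, extended continuously to $X$. Here $\mathcal{L}(X)$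 is the $C^*$-algebra of adjointable operators on $X$, and $\mathcal{K}(X)$ is the closed linear span in $\mathcal{L}(X)$ of the operators $\Theta_{x,y}(z) = x \cdot \langle y, z \rangle_A$, $x, y \in X$. For $\varphi \in C_b(E^1)$ let $\sigma(\varphi) \in \mathcal{L}(X)$ be the multiplication operator which is the continuous extension of $\xi \mapsto \varphi \xi$, $\xi \in C_c(E^1)$. For a continuous function $g : E^1 \to \mathbb{C}$ write $\operatorname{osupp} g = \{\alpha \in E^1 : g(\alpha) \neq 0\}$. (a) For every $\varphi \in C_b(E^1)$, $\sigma(\varphi) \in \mathcal{K}(X)$ if and only if (1) $\varphi \in C_0(E^1)$ and (2) for every $\alpha \in \operatorname{osupp} \varphi$ there is a neighborhood $U$ of $\alpha$ such that $r|_U : U \to r(U)$ is a homeomorphism. (b) For every $f \in C_0(E^0)$, $\phi(f) \in \mathcal{K}(X)$ if and only if (1) $f \circ s \in C_0(E^1)$ and (2) for every $\alpha \in \operatorname{osupp}(f \circ s)$ there is a neighborhood $U$ of $\alpha$ such that $r|_U : U \to r(U)$ is a homeomorphism. -/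

import Mathlib

set_option linter.unusedSectionVars false
set_option maxSynthPendingDepth 3

open MeasureTheory Filter Topology UniformSpace
open scoped ZeroAtInfty CompactlySupported BoundedContinuousFunction

/-- A topological quiver: second countable locally compact Hausdorff spaces `E0` (vertices) and
`E1` (edges), a continuous open map `r`, a continuous map `s`, and Radon measures `lam v` on `E1`
with support `r ⁻¹' {v}` such that `v ↦ ∫ ξ d(lam v)` is in `C_c(E0)` for each `ξ` in `C_c(E1)`. -/
structure TopologicalQuiver (E0 E1 : Type*)
    [TopologicalSpace E0] [T2Space E0] [LocallyCompactSpace E0] [SecondCountableTopology E0]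
    [TopologicalSpace E1] [T2Space E1] [LocallyCompactSpace E1] [SecondCountableTopology E1]
    [MeasurableSpace E1] [BorelSpace E1] where
  /-- the range map -/
  r : E1 → E0
  /-- the source map -/
  s : E1 → E0
  continuous_r : Continuous r
  isOpenMap_r : IsOpenMap r
  continuous_s : Continuous s
  /-- the family of measures on the fibres of `r` -/
  lam : E0 → Measure E1
  regular_lam : ∀ v, (lam v).Regular
  support_lam : ∀ v, (lam v).support = r ⁻¹' {v}
  integral_lam : ∀ ξ : C_c(E1, ℂ), ∃ g : C_c(E0, ℂ), ∀ v, g v = ∫ α, ξ α ∂(lam v)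

namespace TopologicalQuiver

section Quiver

variable {E0 E1 : Type*}
  [TopologicalSpace E0] [T2Space E0] [LocallyCompactSpace E0] [SecondCountableTopology E0]
  [TopologicalSpace E1] [T2Space E1] [LocallyCompactSpace E1] [SecondCountableTopology E1]
  [MeasurableSpace E1] [BorelSpace E1]
  (Q : TopologicalQuiver E0 E1)

instance instRegularLam (v : E0) : (Q.lam v).Regular := Q.regular_lam v

theorem integrable_Cc (v : E0) (ξ : C_c(E1, ℂ)) : Integrable (fun α => ξ α) (Q.lam v) :=
  ξ.continuous.integrable_of_hasCompactSupport ξ.hasCompactSupport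

/-- The `C_0(E0)`-valued inner product on `C_c(E1)`, conjugate linear in the first variable:
`⟨ξ, η⟩ (v) = ∫ conj (ξ α) * η α d(lam v)(α)`. (The measure `lam v` is carried by the fibre
`r ⁻¹' {v}`, so this is the integral over the fibre.) -/
noncomputable def preInner (ξ η : C_c(E1, ℂ)) : C₀(E0, ℂ) where
  toFun v := ∫ α, star (ξ α) * η α ∂(Q.lam v)
  continuous_toFun := by
    obtain ⟨g, hg⟩ := Q.integral_lam (star ξ * η)
    have h : (fun v => ∫ α, star (ξ α) * η α ∂(Q.lam v)) = g := by
      funext v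
      rw [hg v]
      rfl
    rw [h]
    exact g.continuous
  zero_at_infty' := by
    obtain ⟨g, hg⟩ := Q.integral_lam (star ξ * η)
    have h : (fun v => ∫ α, star (ξ α) * η α ∂(Q.lam v)) = g := by
      funext v
      rw [hg v]
      rfl
    rw [h]
    exact zero_at_infty g

theorem preInner_apply (ξ η : C_c(E1, ℂ)) (v : E0) :
    Q.preInner ξ η v = ∫ α, star (ξ α) * η α ∂(Q.lam v) := rfl

theorem integrable_star_mul (v : E0) (ξ η : C_c(E1, ℂ)) :
    Integrable (fun α => star (ξ α) * η α) (Q.lam v) :=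
  Q.integrable_Cc v (star ξ * η)

theorem preInner_add_right (ξ η ζ : C_c(E1, ℂ)) :
    Q.preInner ξ (η + ζ) = Q.preInner ξ η + Q.preInner ξ ζ := by
  ext v
  simp only [ZeroAtInftyContinuousMap.coe_add, Pi.add_apply, preInner_apply,
    CompactlySupportedContinuousMap.add_apply, mul_add]
  exact integral_add (Q.integrable_star_mul v ξ η) (Q.integrable_star_mul v ξ ζ)

theorem preInner_smul_right (c : ℂ) (ξ η : C_c(E1, ℂ)) :
    Q.preInner ξ (c • η) = c • Q.preInner ξ η := by
  ext v
  simp only [ZeroAtInftyContinuousMap.coe_smul, Pi.smul_apply, preInner_apply,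
    CompactlySupportedContinuousMap.smul_apply, smul_eq_mul]
  rw [← integral_const_mul]
  congr 1
  funext α
  ring

theorem star_preInner (ξ η : C_c(E1, ℂ)) : star (Q.preInner ξ η) = Q.preInner η ξ := by
  ext v
  simp only [ZeroAtInftyContinuousMap.star_apply, preInner_apply]
  have h := integral_conj (𝕜 := ℂ) (μ := Q.lam v) (f := fun α => star (ξ α) * η α)
  rw [show star (∫ α, star (ξ α) * η α ∂(Q.lam v)) =
    (starRingEnd ℂ) (∫ α, star (ξ α) * η α ∂(Q.lam v)) from rfl, ← h]
  congr 1
  funext α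
  simp [mul_comm]

theorem preInner_add_left (ξ η ζ : C_c(E1, ℂ)) :
    Q.preInner (ξ + η) ζ = Q.preInner ξ ζ + Q.preInner η ζ := by
  rw [← star_preInner, preInner_add_right, star_add, star_preInner, star_preInner]

theorem preInner_smul_left (c : ℂ) (ξ η : C_c(E1, ℂ)) :
    Q.preInner (c • ξ) η = star c • Q.preInner ξ η := by
  rw [← star_preInner, preInner_smul_right, star_smul, star_preInner]

theorem preInner_self_apply (ξ : C_c(E1, ℂ)) (v : E0) :
    Q.preInner ξ ξ v = ((∫ α, ‖ξ α‖ ^ 2 ∂(Q.lam v) : ℝ) : ℂ) := by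
  rw [preInner_apply, ← integral_complex_ofReal]
  congr 1
  funext α
  rw [show star (ξ α) = (starRingEnd ℂ) (ξ α) from rfl, RCLike.conj_mul]
  simp

/-- The semi-inner product on `C_c(E1)` at a vertex. -/
@[reducible]
noncomputable def fiberCore (v : E0) : PreInnerProductSpace.Core ℂ C_c(E1, ℂ) where
  inner ξ η := Q.preInner ξ η v
  conj_inner_symm ξ η := by
    rw [← Q.star_preInner η ξ]
    rfl
  re_inner_nonneg ξ := by
    rw [preInner_self_apply]
    simp only [RCLike.re_to_complex, Complex.ofReal_re]
    exact integral_nonneg fun α => by positivity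
  add_left ξ η ζ := by
    rw [preInner_add_left]
    rfl
  smul_left ξ η c := by
    rw [preInner_smul_left]
    rfl

/-- The norm of `ξ` in `L²(lam v)`. -/
noncomputable def fiberNorm (v : E0) (ξ : C_c(E1, ℂ)) : ℝ := √((Q.preInner ξ ξ v).re)

theorem fiberNorm_nonneg (v : E0) (ξ : C_c(E1, ℂ)) : 0 ≤ Q.fiberNorm v ξ := Real.sqrt_nonneg _

theorem fiberNorm_add_le (v : E0) (ξ η : C_c(E1, ℂ)) :
    Q.fiberNorm v (ξ + η) ≤ Q.fiberNorm v ξ + Q.fiberNorm v η :=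
  @norm_add_le _
    (@InnerProductSpace.Core.toSeminormedAddCommGroup ℂ _ _ _ _
      (Q.fiberCore v)).toSeminormedAddGroup ξ η

theorem norm_preInner_apply_le (v : E0) (ξ η : C_c(E1, ℂ)) :
    ‖Q.preInner ξ η v‖ ≤ Q.fiberNorm v ξ * Q.fiberNorm v η :=
  @InnerProductSpace.Core.norm_inner_le_norm ℂ _ _ _ _ (Q.fiberCore v) ξ η

theorem norm_preInner_self_apply (v : E0) (ξ : C_c(E1, ℂ)) :
    ‖Q.preInner ξ ξ v‖ = Q.fiberNorm v ξ ^ 2 := by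
  have h : 0 ≤ ∫ α, ‖ξ α‖ ^ 2 ∂(Q.lam v) := integral_nonneg fun α => by positivity
  rw [fiberNorm, preInner_self_apply, Complex.ofReal_re, Real.sq_sqrt h, Complex.norm_real,
    Real.norm_of_nonneg h]

theorem C0_norm_apply_le (f : C₀(E0, ℂ)) (v : E0) : ‖f v‖ ≤ ‖f‖ :=
  f.toBCF.norm_coe_le_norm v

theorem C0_norm_le {f : C₀(E0, ℂ)} {C : ℝ} (hC : 0 ≤ C) (h : ∀ v, ‖f v‖ ≤ C) : ‖f‖ ≤ C :=
  (BoundedContinuousFunction.norm_le (f := f.toBCF) hC).2 h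

/-- The space `C_c(E1)`, as the space carrying the seminorm of the quiver `Q`. -/
def PreX (_Q : TopologicalQuiver E0 E1) : Type _ := C_c(E1, ℂ)

noncomputable instance instAddCommGroupPreX : AddCommGroup Q.PreX :=
  inferInstanceAs (AddCommGroup C_c(E1, ℂ))

noncomputable instance instModulePreX : Module ℂ Q.PreX :=
  inferInstanceAs (Module ℂ C_c(E1, ℂ))

/-- The identity map from `PreX` to `C_c(E1)`. -/
noncomputable def toCc : Q.PreX ≃ₗ[ℂ] C_c(E1, ℂ) := LinearEquiv.refl ℂ C_c(E1, ℂ)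

/-- The norm `‖ξ‖ = ‖⟨ξ, ξ⟩‖ ^ (1 / 2)`, with the supremum norm on `C_0(E0)`. -/
noncomputable instance instNormPreX : Norm Q.PreX :=
  ⟨fun ξ => √‖Q.preInner (Q.toCc ξ) (Q.toCc ξ)‖⟩

theorem preNorm_def (ξ : Q.PreX) : ‖ξ‖ = √‖Q.preInner (Q.toCc ξ) (Q.toCc ξ)‖ := rfl

theorem preNorm_nonneg (ξ : Q.PreX) : 0 ≤ ‖ξ‖ := Real.sqrt_nonneg _

theorem fiberNorm_le_preNorm (v : E0) (ξ : Q.PreX) : Q.fiberNorm v (Q.toCc ξ) ≤ ‖ξ‖ := by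
  rw [preNorm_def]
  apply Real.le_sqrt_of_sq_le
  rw [← norm_preInner_self_apply]
  exact C0_norm_apply_le _ v

theorem preNorm_le {ξ : Q.PreX} {C : ℝ} (hC : 0 ≤ C) (h : ∀ v, Q.fiberNorm v (Q.toCc ξ) ≤ C) :
    ‖ξ‖ ≤ C := by
  rw [preNorm_def]
  apply Real.sqrt_le_iff.2 ⟨hC, C0_norm_le (by positivity) fun v => ?_⟩
  rw [norm_preInner_self_apply]
  exact pow_le_pow_left₀ (Q.fiberNorm_nonneg v _) (h v) 2

theorem preX_core : SeminormedSpace.Core ℂ Q.PreX where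
  norm_nonneg ξ := Q.preNorm_nonneg ξ
  norm_smul c ξ := by
    rw [preNorm_def, preNorm_def]
    have h : Q.preInner (Q.toCc (c • ξ)) (Q.toCc (c • ξ)) =
        (star c * c) • Q.preInner (Q.toCc ξ) (Q.toCc ξ) := by
      rw [map_smul, mul_smul, preInner_smul_left, preInner_smul_right]
    rw [h, norm_smul, norm_mul, norm_star, Real.sqrt_mul (by positivity),
      Real.sqrt_mul_self (norm_nonneg c)]
  norm_triangle ξ η := by
    refine Q.preNorm_le (add_nonneg (Q.preNorm_nonneg ξ) (Q.preNorm_nonneg η)) fun v => ?_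
    rw [map_add]
    exact (Q.fiberNorm_add_le v _ _).trans
      (add_le_add (Q.fiberNorm_le_preNorm v ξ) (Q.fiberNorm_le_preNorm v η))

noncomputable instance instSeminormedAddCommGroupPreX : SeminormedAddCommGroup Q.PreX :=
  SeminormedAddCommGroup.ofCore Q.preX_core

noncomputable instance instNormedSpacePreX : NormedSpace ℂ Q.PreX where
  norm_smul_le c ξ := le_of_eq (Q.preX_core.norm_smul c ξ)

/-- The Hilbert `C_0(E0)`-module `X` of the quiver: the completion of `C_c(E1)`. -/
def X : Type _ := Completion Q.PreX

noncomputable instance instNormedAddCommGroupX : NormedAddCommGroup Q.X :=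
  inferInstanceAs (NormedAddCommGroup (Completion Q.PreX))

noncomputable instance instNormedSpaceX : NormedSpace ℂ Q.X :=
  inferInstanceAs (NormedSpace ℂ (Completion Q.PreX))

instance instCompleteSpaceX : CompleteSpace Q.X :=
  inferInstanceAs (CompleteSpace (Completion Q.PreX))

/-- The canonical map from `C_c(E1)` to its completion `X`. -/
noncomputable def toX : C_c(E1, ℂ) →ₗ[ℂ] Q.X :=
  (Completion.toComplL (𝕜 := ℂ) (E := Q.PreX)).toLinearMap ∘ₗ Q.toCc.symm.toLinearMap

theorem norm_toX (ξ : C_c(E1, ℂ)) : ‖Q.toX ξ‖ = √‖Q.preInner ξ ξ‖ :=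
  Completion.norm_coe (Q.toCc.symm ξ)

theorem norm_toX_eq (ξ : C_c(E1, ℂ)) : ‖Q.toX ξ‖ = ‖Q.toCc.symm ξ‖ := Q.norm_toX ξ

theorem denseRange_toX : DenseRange Q.toX :=
  Completion.denseRange_coe.comp Q.toCc.symm.surjective.denseRange
    (Completion.continuous_coe Q.PreX)

/-- A continuous identity in `X` may be checked on `C_c(E1)`. -/
theorem X_ext {Y : Type*} [TopologicalSpace Y] [T2Space Y] {f g : Q.X → Y} (hf : Continuous f)
    (hg : Continuous g) (h : ∀ ξ, f (Q.toX ξ) = g (Q.toX ξ)) (x : Q.X) : f x = g x :=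
  congrFun (Q.denseRange_toX.equalizer hf hg (funext h)) x

theorem norm_preInner_le (ξ η : C_c(E1, ℂ)) :
    ‖Q.preInner ξ η‖ ≤ ‖Q.toX ξ‖ * ‖Q.toX η‖ := by
  refine C0_norm_le (by positivity) fun v => ?_
  rw [norm_toX_eq, norm_toX_eq]
  exact (Q.norm_preInner_apply_le v _ _).trans
    (mul_le_mul (Q.fiberNorm_le_preNorm v (Q.toCc.symm ξ))
      (Q.fiberNorm_le_preNorm v (Q.toCc.symm η))
      (Q.fiberNorm_nonneg v _) (Q.preNorm_nonneg _))

/-- `η ↦ ⟨ξ, η⟩` as a linear map on `C_c(E1)`. -/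
noncomputable def preInnerₗ (ξ : C_c(E1, ℂ)) : C_c(E1, ℂ) →ₗ[ℂ] C₀(E0, ℂ) where
  toFun η := Q.preInner ξ η
  map_add' η ζ := Q.preInner_add_right ξ η ζ
  map_smul' c η := Q.preInner_smul_right c ξ η

/-- `⟨ξ, ·⟩` for `ξ` in `C_c(E1)`, extended continuously to `X`. -/
noncomputable def innerCc (ξ : C_c(E1, ℂ)) : Q.X →L[ℂ] C₀(E0, ℂ) :=
  (Q.preInnerₗ ξ).extendOfNorm Q.toX

theorem innerCc_toX (ξ η : C_c(E1, ℂ)) : Q.innerCc ξ (Q.toX η) = Q.preInner ξ η :=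
  LinearMap.extendOfNorm_eq (f := Q.preInnerₗ ξ) Q.denseRange_toX
    ⟨‖Q.toX ξ‖, Q.norm_preInner_le ξ⟩ η

theorem norm_innerCc_apply_le (ξ : C_c(E1, ℂ)) (y : Q.X) :
    ‖Q.innerCc ξ y‖ ≤ ‖Q.toX ξ‖ * ‖y‖ :=
  LinearMap.norm_extendOfNorm_apply_le (f := Q.preInnerₗ ξ) Q.denseRange_toX _
    (Q.norm_preInner_le ξ) y

/-- `ξ ↦ ⟨ξ, ·⟩` as a conjugate linear map on `C_c(E1)`. -/
noncomputable def innerCcₗ : C_c(E1, ℂ) →ₗ⋆[ℂ] Q.X →L[ℂ] C₀(E0, ℂ) where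
  toFun ξ := Q.innerCc ξ
  map_add' ξ η := by
    ext1 y
    refine Q.X_ext (f := fun y => Q.innerCc (ξ + η) y)
      (g := fun y => Q.innerCc ξ y + Q.innerCc η y) (by fun_prop) (by fun_prop) (fun ζ => ?_) y
    simp only [innerCc_toX, preInner_add_left]
  map_smul' c ξ := by
    ext1 y
    refine Q.X_ext (f := fun y => Q.innerCc (c • ξ) y)
      (g := fun y => star c • Q.innerCc ξ y) (by fun_prop) (by fun_prop) (fun ζ => ?_) y
    simp only [innerCc_toX, preInner_smul_left]

/-- The `C_0(E0)`-valued inner product on `X`: the continuous extension of `preInner`. -/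
noncomputable def innerX : Q.X →L⋆[ℂ] Q.X →L[ℂ] C₀(E0, ℂ) :=
  Q.innerCcₗ.extendOfNorm Q.toX

theorem innerX_toX_left (ξ : C_c(E1, ℂ)) : Q.innerX (Q.toX ξ) = Q.innerCc ξ :=
  LinearMap.extendOfNorm_eq (f := Q.innerCcₗ) Q.denseRange_toX
    ⟨1, fun ξ => by
      rw [one_mul]
      exact ContinuousLinearMap.opNorm_le_bound _ (norm_nonneg _) (Q.norm_innerCc_apply_le ξ)⟩ ξ

theorem innerX_toX (ξ η : C_c(E1, ℂ)) : Q.innerX (Q.toX ξ) (Q.toX η) = Q.preInner ξ η := by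
  rw [innerX_toX_left, innerCc_toX]

/-- The pointwise product of a bounded continuous function with a function in `C_c(E1)`. -/
noncomputable def mulCc (φ : E1 →ᵇ ℂ) : C_c(E1, ℂ) →ₗ[ℂ] C_c(E1, ℂ) where
  toFun ξ :=
    { toFun := fun α => φ α * ξ α
      continuous_toFun := φ.continuous.mul ξ.continuous
      hasCompactSupport' := ξ.hasCompactSupport.mul_left }
  map_add' ξ η := by
    ext α
    exact mul_add (φ α) (ξ α) (η α)
  map_smul' c ξ := by
    ext α
    exact mul_left_comm (φ α) c (ξ α)

theorem mulCc_apply (φ : E1 →ᵇ ℂ) (ξ : C_c(E1, ℂ)) (α : E1) : mulCc φ ξ α = φ α * ξ α := rfl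

theorem integrable_norm_sq (v : E0) (η : C_c(E1, ℂ)) :
    Integrable (fun α => ‖η α‖ ^ 2) (Q.lam v) := by
  have h : HasCompactSupport fun α => ‖η α‖ ^ 2 := by
    refine HasCompactSupport.intro η.hasCompactSupport fun α hα => ?_
    rw [image_eq_zero_of_notMem_tsupport hα]
    simp
  exact Continuous.integrable_of_hasCompactSupport (η.continuous.norm.pow 2) h

theorem fiberNorm_mulCc_le (v : E0) (φ : E1 →ᵇ ℂ) (ξ : C_c(E1, ℂ)) :
    Q.fiberNorm v (mulCc φ ξ) ≤ ‖φ‖ * Q.fiberNorm v ξ := by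
  rw [fiberNorm, fiberNorm, preInner_self_apply, preInner_self_apply, Complex.ofReal_re,
    Complex.ofReal_re]
  apply Real.sqrt_le_iff.2 ⟨by positivity, ?_⟩
  rw [mul_pow, Real.sq_sqrt (integral_nonneg fun α => by positivity), ← integral_const_mul]
  refine integral_mono (Q.integrable_norm_sq v _) ((Q.integrable_norm_sq v ξ).const_mul _)
    fun α => ?_
  simp only [mulCc_apply, norm_mul, mul_pow]
  gcongr
  exact φ.norm_coe_le_norm α

theorem norm_toX_mulCc_le (φ : E1 →ᵇ ℂ) (ξ : C_c(E1, ℂ)) :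
    ‖Q.toX (mulCc φ ξ)‖ ≤ ‖φ‖ * ‖Q.toX ξ‖ := by
  rw [norm_toX_eq, norm_toX_eq]
  exact Q.preNorm_le (mul_nonneg (norm_nonneg φ) (Q.preNorm_nonneg _)) fun v =>
    (Q.fiberNorm_mulCc_le v φ ξ).trans (mul_le_mul_of_nonneg_left
      (Q.fiberNorm_le_preNorm v (Q.toCc.symm ξ)) (norm_nonneg φ))

/-- The multiplication operator `σ(φ)` on `X` for `φ` in `C_b(E1)`: the continuous extension to `X`
of `ξ ↦ φ ξ` on `C_c(E1)`. -/
noncomputable def sigma (φ : E1 →ᵇ ℂ) : Q.X →L[ℂ] Q.X :=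
  (Q.toX ∘ₗ mulCc φ).extendOfNorm Q.toX

theorem sigma_toX (φ : E1 →ᵇ ℂ) (ξ : C_c(E1, ℂ)) : Q.sigma φ (Q.toX ξ) = Q.toX (mulCc φ ξ) :=
  LinearMap.extendOfNorm_eq (f := Q.toX ∘ₗ mulCc φ) Q.denseRange_toX
    ⟨‖φ‖, Q.norm_toX_mulCc_le φ⟩ ξ

theorem norm_sigma_apply_le (φ : E1 →ᵇ ℂ) (x : Q.X) : ‖Q.sigma φ x‖ ≤ ‖φ‖ * ‖x‖ :=
  LinearMap.norm_extendOfNorm_apply_le (f := Q.toX ∘ₗ mulCc φ) Q.denseRange_toX _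
    (Q.norm_toX_mulCc_le φ) x

theorem sigma_add (φ ψ : E1 →ᵇ ℂ) : Q.sigma (φ + ψ) = Q.sigma φ + Q.sigma ψ := by
  ext1 x
  refine Q.X_ext (f := fun x => Q.sigma (φ + ψ) x) (g := fun x => Q.sigma φ x + Q.sigma ψ x)
    (by fun_prop) (by fun_prop) (fun ξ => ?_) x
  simp only [sigma_toX, ← map_add]
  congr 1
  ext α
  exact add_mul (φ α) (ψ α) (ξ α)

theorem sigma_smul (c : ℂ) (φ : E1 →ᵇ ℂ) : Q.sigma (c • φ) = c • Q.sigma φ := by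
  ext1 x
  refine Q.X_ext (f := fun x => Q.sigma (c • φ) x) (g := fun x => c • Q.sigma φ x)
    (Q.sigma (c • φ)).continuous (c • Q.sigma φ).continuous (fun ξ => ?_) x
  simp only [sigma_toX]
  rw [← LinearMap.map_smul Q.toX c]
  congr 1
  ext α
  exact mul_assoc c (φ α) (ξ α)

/-- For `f` in `C_0(E0)` and `g : E1 → E0` continuous, the bounded continuous function `f ∘ g`. -/
noncomputable def pullback (f : C₀(E0, ℂ)) (g : C(E1, E0)) : E1 →ᵇ ℂ := f.toBCF.compContinuous g

theorem pullback_apply (f : C₀(E0, ℂ)) (g : C(E1, E0)) (α : E1) : pullback f g α = f (g α) := rfl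

theorem norm_pullback_le (f : C₀(E0, ℂ)) (g : C(E1, E0)) : ‖pullback f g‖ ≤ ‖f‖ :=
  (BoundedContinuousFunction.norm_le (norm_nonneg f)).2 fun α => C0_norm_apply_le f (g α)

/-- The left action `φ(f)` of `C_0(E0)` on `X`: the extension of `ξ ↦ (f ∘ s) ξ`. -/
noncomputable def leftAction (f : C₀(E0, ℂ)) : Q.X →L[ℂ] Q.X :=
  Q.sigma (pullback f ⟨Q.s, Q.continuous_s⟩)

/-- The right action of `C_0(E0)` on `X`: `rightAction f x` is `x · f`, the extension of
`ξ ↦ ξ (f ∘ r)`. -/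
noncomputable def rightAction (f : C₀(E0, ℂ)) : Q.X →L[ℂ] Q.X :=
  Q.sigma (pullback f ⟨Q.r, Q.continuous_r⟩)

theorem leftAction_toX (f : C₀(E0, ℂ)) (ξ η : C_c(E1, ℂ)) (h : ∀ α, η α = f (Q.s α) * ξ α) :
    Q.leftAction f (Q.toX ξ) = Q.toX η := by
  rw [leftAction, sigma_toX]
  congr 1
  ext α
  exact (h α).symm

theorem rightAction_toX (f : C₀(E0, ℂ)) (ξ η : C_c(E1, ℂ)) (h : ∀ α, η α = ξ α * f (Q.r α)) :
    Q.rightAction f (Q.toX ξ) = Q.toX η := by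
  rw [rightAction, sigma_toX]
  congr 1
  ext α
  rw [h α, mul_comm]
  rfl

theorem rightAction_add (f g : C₀(E0, ℂ)) :
    Q.rightAction (f + g) = Q.rightAction f + Q.rightAction g := by
  unfold rightAction
  rw [← sigma_add]
  rfl

theorem rightAction_smul (c : ℂ) (f : C₀(E0, ℂ)) :
    Q.rightAction (c • f) = c • Q.rightAction f := by
  unfold rightAction
  rw [← sigma_smul]
  rfl

theorem norm_rightAction_le (f : C₀(E0, ℂ)) (x : Q.X) : ‖Q.rightAction f x‖ ≤ ‖f‖ * ‖x‖ :=
  (Q.norm_sigma_apply_le _ x).trans (mul_le_mul_of_nonneg_right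
    (norm_pullback_le f _) (norm_nonneg x))

theorem norm_innerX_le (x y : Q.X) : ‖Q.innerX x y‖ ≤ ‖x‖ * ‖y‖ := by
  refine Q.denseRange_toX.induction_on (p := fun x => ‖Q.innerX x y‖ ≤ ‖x‖ * ‖y‖) x
    (isClosed_le (by fun_prop) (by fun_prop)) fun ξ => ?_
  rw [innerX_toX_left]
  exact Q.norm_innerCc_apply_le ξ y

/-- The map `z ↦ x · ⟨y, z⟩` as a linear map. -/
noncomputable def thetaₗ (x y : Q.X) : Q.X →ₗ[ℂ] Q.X where
  toFun z := Q.rightAction (Q.innerX y z) x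
  map_add' z w := by
    rw [ContinuousLinearMap.map_add (Q.innerX y) z w, rightAction_add, add_apply]
  map_smul' c z := by
    rw [ContinuousLinearMap.map_smul (Q.innerX y) c z, rightAction_smul, smul_apply,
      RingHom.id_apply]

theorem norm_thetaₗ_le (x y z : Q.X) : ‖Q.thetaₗ x y z‖ ≤ ‖y‖ * ‖x‖ * ‖z‖ := by
  have h : ‖Q.rightAction (Q.innerX y z) x‖ ≤ ‖Q.innerX y z‖ * ‖x‖ :=
    Q.norm_rightAction_le (Q.innerX y z) x
  have h' := Q.norm_innerX_le y z
  have h'' : ‖Q.innerX y z‖ * ‖x‖ ≤ (‖y‖ * ‖z‖) * ‖x‖ := by gcongr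
  exact (h.trans h'').trans (le_of_eq (mul_right_comm _ _ _))

/-- The rank one operator `Θ_{x,y} (z) = x · ⟨y, z⟩` on `X`. -/
noncomputable def theta (x y : Q.X) : Q.X →L[ℂ] Q.X :=
  (Q.thetaₗ x y).mkContinuous (‖y‖ * ‖x‖) (Q.norm_thetaₗ_le x y)

theorem theta_apply (x y z : Q.X) : Q.theta x y z = Q.rightAction (Q.innerX y z) x := rfl

theorem continuous_innerX : Continuous fun p : Q.X × Q.X => Q.innerX p.1 p.2 := by
  fun_prop

theorem X_ext₂ {Y : Type*} [TopologicalSpace Y] [T2Space Y] {f g : Q.X → Q.X → Y}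
    (hf : Continuous fun p : Q.X × Q.X => f p.1 p.2)
    (hg : Continuous fun p : Q.X × Q.X => g p.1 p.2)
    (h : ∀ ξ η, f (Q.toX ξ) (Q.toX η) = g (Q.toX ξ) (Q.toX η)) (x y : Q.X) : f x y = g x y :=
  congrFun ((Q.denseRange_toX.prodMap Q.denseRange_toX).equalizer hf hg
    (funext fun p => h p.1 p.2)) (x, y)

theorem star_innerX (x y : Q.X) : star (Q.innerX x y) = Q.innerX y x :=
  Q.X_ext₂ (f := fun x y => star (Q.innerX x y)) (g := fun x y => Q.innerX y x)
    (continuous_star.comp Q.continuous_innerX) (Q.continuous_innerX.comp continuous_swap)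
    (fun ξ η => by simp only [innerX_toX, star_preInner]) x y

theorem norm_sq_eq_norm_innerX (x : Q.X) : ‖x‖ ^ 2 = ‖Q.innerX x x‖ := by
  refine Q.X_ext (f := fun x => ‖x‖ ^ 2) (g := fun x => ‖Q.innerX x x‖) (by fun_prop)
    (by fun_prop) (fun ξ => ?_) x
  simp only [innerX_toX]
  rw [norm_toX, Real.sq_sqrt (norm_nonneg _)]

theorem innerX_sigma_left (φ : E1 →ᵇ ℂ) (x y : Q.X) :
    Q.innerX (Q.sigma φ x) y = Q.innerX x (Q.sigma (star φ) y) := by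
  refine Q.X_ext₂ (f := fun x y => Q.innerX (Q.sigma φ x) y)
    (g := fun x y => Q.innerX x (Q.sigma (star φ) y)) (by fun_prop) (by fun_prop)
    (fun ξ η => ?_) x y
  simp only [sigma_toX, innerX_toX]
  ext v
  simp only [preInner_apply, mulCc_apply]
  congr 1
  funext α
  rw [star_mul', BoundedContinuousFunction.star_apply]
  ring

theorem innerX_rightAction_right (f : C₀(E0, ℂ)) (x y : Q.X) :
    Q.innerX x (Q.rightAction f y) = Q.innerX x y * f := by
  refine Q.X_ext₂ (f := fun x y => Q.innerX x (Q.rightAction f y))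
    (g := fun x y => Q.innerX x y * f) (by fun_prop) (by fun_prop) (fun ξ η => ?_) x y
  simp only [rightAction, sigma_toX, innerX_toX]
  ext v
  simp only [preInner_apply, mulCc_apply, ZeroAtInftyContinuousMap.mul_apply]
  rw [← integral_mul_const]
  have hmem : ∀ᵐ α ∂(Q.lam v), α ∈ (Q.lam v).support :=
    Measure.support_mem_ae
  refine integral_congr_ae (hmem.mono fun α hα => ?_)
  rw [Q.support_lam v] at hα
  have hr : Q.r α = v := hα
  simp only [pullback_apply, ContinuousMap.coe_mk, hr]
  ring

/-- The algebra `L(X)` of adjointable operators on `X`. -/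
noncomputable def adjointable : Subalgebra ℂ (Q.X →L[ℂ] Q.X) where
  carrier := {T | ∃ S : Q.X →L[ℂ] Q.X, ∀ x y, Q.innerX (T x) y = Q.innerX x (S y)}
  mul_mem' := by
    rintro T T' ⟨S, hS⟩ ⟨S', hS'⟩
    exact ⟨S' * S, fun x y => by
      rw [mul_apply_eq_comp, mul_apply_eq_comp, hS, hS']⟩
  add_mem' := by
    rintro T T' ⟨S, hS⟩ ⟨S', hS'⟩
    exact ⟨S + S', fun x y => by
      rw [add_apply, add_apply, map_add, map_add,
        add_apply, hS, hS']⟩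
  algebraMap_mem' c := ⟨star c • 1, fun x y => by
    rw [Algebra.algebraMap_eq_smul_one, smul_apply, smul_apply, one_apply_eq_self,
      one_apply_eq_self]
    exact (congrArg (fun T : Q.X →L[ℂ] C₀(E0, ℂ) => T y)
      (ContinuousLinearMap.map_smulₛₗ Q.innerX c x)).trans
      (ContinuousLinearMap.map_smul (Q.innerX x) (star c) y).symm⟩

theorem sigma_mem_adjointable (φ : E1 →ᵇ ℂ) : Q.sigma φ ∈ Q.adjointable :=
  ⟨Q.sigma (star φ), Q.innerX_sigma_left φ⟩

theorem theta_mem_adjointable (x y : Q.X) : Q.theta x y ∈ Q.adjointable := by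
  refine ⟨Q.theta y x, fun z w => ?_⟩
  rw [theta_apply, theta_apply, ← star_innerX, innerX_rightAction_right,
    innerX_rightAction_right, star_mul, star_innerX, star_innerX, mul_comm]

/-- `σ(φ)` as an element of `L(X)`. -/
noncomputable def sigmaL (φ : E1 →ᵇ ℂ) : Q.adjointable := ⟨Q.sigma φ, Q.sigma_mem_adjointable φ⟩

/-- `φ(f)` as an element of `L(X)`. -/
noncomputable def leftActionL (f : C₀(E0, ℂ)) : Q.adjointable :=
  ⟨Q.leftAction f, Q.sigma_mem_adjointable _⟩

/-- `Θ_{x,y}` as an element of `L(X)`. -/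
noncomputable def thetaL (x y : Q.X) : Q.adjointable := ⟨Q.theta x y, Q.theta_mem_adjointable x y⟩

/-- The compact operators `K(X)`: the closed linear span, in the operator norm of `L(X)`, of the
operators `Θ_{x,y}`. -/
noncomputable def compacts : Submodule ℂ Q.adjointable :=
  (Submodule.span ℂ {T | ∃ x y : Q.X, T = Q.thetaL x y}).topologicalClosure

/-- The open support of a complex valued function. -/
def osupp (g : E1 → ℂ) : Set E1 := {α | g α ≠ 0}

end Quiver

end TopologicalQuiver

/-! Necessity. Since `‖Θ_{x,y} z‖ ≤ ‖x‖ ‖⟨y, z⟩‖`, a compact operator is small on any shrinking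
family of test vectors on which every functional `⟨η, ·⟩`, `η ∈ C_c(E1)`, is eventually small
(`eventually_norm_le_of_mem_compacts`). Two families are used. Functions supported off large compact
sets are orthogonal to `η`, and this forces `φ` to vanish at infinity. Functions supported near `α₀`
with all fibre integrals zero satisfy `⟨η, ζ⟩ = ⟨η - η(α₀), ζ⟩`, which is small; if two points near
`α₀` shared a fibre, there would be a nonzero such `ζ`, on which `σ(φ)` is bounded below when `φ α₀
≠ 0`.

Sufficiency. If `r` is injective on an open set `U`, each fibre meets `U` in at most one point, so
fibre integrals over `U` are evaluations up to a weight, and `σ(ψ)` has rank one for `ψ` compactly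
supported in `U` (`exists_sigma_eq_theta`). A partition of unity and a uniform approximation give
the general case. Since `r` is open, local injectivity is the same as condition (2). Part (b) is
part (a) for `φ = f ∘ s`. -/

namespace TopologicalQuiver

section Compacts

variable {E0 E1 : Type*}
  [TopologicalSpace E0] [T2Space E0] [LocallyCompactSpace E0] [SecondCountableTopology E0]
  [TopologicalSpace E1] [T2Space E1] [LocallyCompactSpace E1] [SecondCountableTopology E1]
  [MeasurableSpace E1] [BorelSpace E1]
  (Q : TopologicalQuiver E0 E1)

/-! ### Bump functions, norms and fibre integrals -/

/-- Urysohn's lemma with values in `C_c(E1)`. -/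
theorem exists_Cc_one_of_isCompact_subset_isOpen {K U : Set E1} (hK : IsCompact K) (hU : IsOpen U)
    (hKU : K ⊆ U) :
    ∃ y : C_c(E1, ℂ), (∀ α ∈ K, y α = 1) ∧ ∀ α ∉ U, y α = 0 := by
  obtain ⟨f, hf1, hf0, hfc, -⟩ := exists_continuous_one_zero_of_isCompact hK hU.isClosed_compl
    (Set.disjoint_compl_right_iff_subset.2 hKU)
  refine ⟨⟨⟨fun α => (f α : ℂ), by fun_prop⟩, hfc.comp_left Complex.ofReal_zero⟩,
    fun α hα => ?_, fun α hα => ?_⟩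
  · change (f α : ℂ) = 1
    simp [hf1 hα]
  · change (f α : ℂ) = 0
    simp [hf0 hα]

theorem norm_toX_mono {ξ η : C_c(E1, ℂ)} (h : ∀ α, ‖ξ α‖ ≤ ‖η α‖) : ‖Q.toX ξ‖ ≤ ‖Q.toX η‖ := by
  rw [norm_toX_eq, norm_toX_eq]
  refine Q.preNorm_le (Q.preNorm_nonneg _) fun v =>
    le_trans ?_ (Q.fiberNorm_le_preNorm v (Q.toCc.symm η))
  rw [fiberNorm, fiberNorm, preInner_self_apply, preInner_self_apply, Complex.ofReal_re,
    Complex.ofReal_re]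
  exact Real.sqrt_le_sqrt (integral_mono (Q.integrable_norm_sq v _) (Q.integrable_norm_sq v _)
    fun α => pow_le_pow_left₀ (norm_nonneg _) (h α) 2)

/-- The support of `lam (r α)` is the whole fibre through `α`, so this measure charges every
neighbourhood of `α`. -/
theorem preInner_self_ne_zero {ξ : C_c(E1, ℂ)} {α : E1} (h : ξ α ≠ 0) :
    Q.preInner ξ ξ (Q.r α) ≠ 0 := by
  intro h0
  rw [preInner_self_apply, Complex.ofReal_eq_zero,
    integral_eq_zero_iff_of_nonneg (fun α => by positivity) (Q.integrable_norm_sq _ ξ)] at h0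
  have hα : α ∈ (Q.lam (Q.r α)).support := by
    rw [Q.support_lam]
    rfl
  have hU : {β | ξ β ≠ 0} ∈ 𝓝 α := (isOpen_ne_fun ξ.continuous continuous_const).mem_nhds h
  refine ((Measure.mem_support_iff_forall α).1 hα _ hU).ne' ?_
  refine measure_mono_null (fun β hβ => ?_) h0
  simpa using hβ

theorem norm_toX_pos {ξ : C_c(E1, ℂ)} {α : E1} (h : ξ α ≠ 0) : 0 < ‖Q.toX ξ‖ := by
  rw [norm_toX]
  refine Real.sqrt_pos.2 (norm_pos_iff.2 fun h0 => Q.preInner_self_ne_zero h ?_)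
  rw [h0]
  rfl

theorem ae_lam_r_eq (v : E0) : ∀ᵐ α ∂(Q.lam v), Q.r α = v := by
  have h : ∀ᵐ α ∂(Q.lam v), α ∈ (Q.lam v).support := Measure.support_mem_ae
  rw [Q.support_lam v] at h
  exact h

/-- A function pulled back along `r` is constant on each fibre, hence leaves the integral. This
gives the cancellation in the test function of `exists_injOn_r_of_sigmaL_mem_compacts`. -/
theorem integral_mulCc_pullback_r (f : C₀(E0, ℂ)) (ξ : C_c(E1, ℂ)) (v : E0) :
    ∫ α, mulCc (pullback f ⟨Q.r, Q.continuous_r⟩) ξ α ∂(Q.lam v) =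
      f v * ∫ α, ξ α ∂(Q.lam v) := by
  rw [← integral_const_mul]
  refine integral_congr_ae ((Q.ae_lam_r_eq v).mono fun α hα => ?_)
  simp only [mulCc_apply, pullback_apply, ContinuousMap.coe_mk, hα]

/-! ### Compact operators on shrinking test families -/

/-- If each functional `⟨η, ·⟩`, for `η` in `C_c(E1)`, is eventually small on the sets `S i`, then
so is each compact operator. -/
theorem eventually_norm_le_of_mem_compacts {ι : Type*} {l : Filter ι} {S : ι → Set Q.X}
    (hS : ∀ (η : C_c(E1, ℂ)), ∀ ε > 0, ∀ᶠ i in l, ∀ z ∈ S i, ‖Q.innerX (Q.toX η) z‖ ≤ ε * ‖z‖)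
    {T : Q.adjointable} (hT : T ∈ Q.compacts) :
    ∀ ε > 0, ∀ᶠ i in l, ∀ z ∈ S i, ‖T.1 z‖ ≤ ε * ‖z‖ := by
  -- Density of `C_c(E1)` suffices because the bound is relative to `‖z‖`: the error `⟨y - η, z⟩` is
  -- at most `‖y - η‖ ‖z‖`, uniformly in `z` and `i`.
  have hX : ∀ (y : Q.X), ∀ ε > 0, ∀ᶠ i in l, ∀ z ∈ S i, ‖Q.innerX y z‖ ≤ ε * ‖z‖ := by
    intro y ε hε
    obtain ⟨η, hη⟩ := Q.denseRange_toX.exists_dist_lt y (half_pos hε)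
    filter_upwards [hS η (ε / 2) (half_pos hε)] with i hi z hz
    have h1 : Q.innerX y z = Q.innerX (y - Q.toX η) z + Q.innerX (Q.toX η) z := by
      rw [map_sub, sub_apply, sub_add_cancel]
    rw [h1]
    refine (norm_add_le _ _).trans ?_
    have h2 : ‖Q.innerX (y - Q.toX η) z‖ ≤ ε / 2 * ‖z‖ := by
      refine (Q.norm_innerX_le _ _).trans ?_
      rw [← dist_eq_norm]
      gcongr
    linarith [hi z hz]
  have hspan : ∀ T ∈ Submodule.span ℂ {T | ∃ x y : Q.X, T = Q.thetaL x y},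
      ∀ ε > 0, ∀ᶠ i in l, ∀ z ∈ S i, ‖T.1 z‖ ≤ ε * ‖z‖ := by
    intro T hT
    induction hT using Submodule.span_induction with
    | mem T hT =>
      obtain ⟨x, y, rfl⟩ := hT
      intro ε hε
      have hx : 0 < ‖x‖ + 1 := by positivity
      filter_upwards [hX y (ε / (‖x‖ + 1)) (by positivity)] with i hi z hz
      change ‖Q.rightAction (Q.innerX y z) x‖ ≤ _
      calc ‖Q.rightAction (Q.innerX y z) x‖ ≤ ‖Q.innerX y z‖ * ‖x‖ := Q.norm_rightAction_le _ x
        _ ≤ ε / (‖x‖ + 1) * ‖z‖ * (‖x‖ + 1) := by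
          gcongr
          · exact hi z hz
          · linarith
        _ = ε * ‖z‖ := by field_simp
    | zero =>
      intro ε hε
      refine Eventually.of_forall fun i z _ => ?_
      change ‖(0 : Q.X)‖ ≤ _
      rw [norm_zero]
      positivity
    | add T T' _ _ h h' =>
      intro ε hε
      filter_upwards [h _ (half_pos hε), h' _ (half_pos hε)] with i hi hi' z hz
      change ‖T.1 z + T'.1 z‖ ≤ _
      linarith [norm_add_le (T.1 z) (T'.1 z), hi z hz, hi' z hz]
    | smul c T _ h =>
      intro ε hε
      have hc : 0 < ‖c‖ + 1 := by positivity
      filter_upwards [h (ε / (‖c‖ + 1)) (by positivity)] with i hi z hz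
      change ‖c • T.1 z‖ ≤ _
      rw [norm_smul]
      calc ‖c‖ * ‖T.1 z‖ ≤ (‖c‖ + 1) * (ε / (‖c‖ + 1) * ‖z‖) := by
            gcongr
            · linarith
            · exact hi z hz
        _ = ε * ‖z‖ := by field_simp
  intro ε hε
  obtain ⟨T', hT', hd⟩ := Metric.mem_closure_iff.1 hT (ε / 2) (half_pos hε)
  filter_upwards [hspan T' hT' (ε / 2) (half_pos hε)] with i hi z hz
  have h1 : T.1 z = (T.1 - T'.1) z + T'.1 z := by rw [sub_apply, sub_add_cancel]
  rw [h1]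
  refine (norm_add_le _ _).trans ?_
  have h2 : ‖(T.1 - T'.1) z‖ ≤ ε / 2 * ‖z‖ := by
    refine (ContinuousLinearMap.le_opNorm _ z).trans ?_
    rw [← dist_eq_norm]
    exact mul_le_mul_of_nonneg_right hd.le (norm_nonneg z)
  linarith [hi z hz]

/-! ### Necessity: vanishing at infinity -/

/-- An operator `σ(φ)` that is bounded by `ε` on functions supported in an open set `U` has
`|φ| ≤ ε` on `U`. -/
theorem norm_apply_le_of_norm_toX_mulCc_le {φ : E1 →ᵇ ℂ} {U : Set E1} (hU : IsOpen U) {ε : ℝ}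
    (h : ∀ ζ : C_c(E1, ℂ), (∀ β ∉ U, ζ β = 0) → ‖Q.toX (mulCc φ ζ)‖ ≤ ε * ‖Q.toX ζ‖)
    {α : E1} (hα : α ∈ U) : ‖φ α‖ ≤ ε := by
  by_contra! hlt
  obtain ⟨c, hεc, hc⟩ := exists_between hlt
  -- A bump `ζ` supported where `c < |φ|` satisfies `‖φ ζ‖ ≥ c ‖ζ‖` once `c` is positive,
  -- contradicting the bound by `ε < c`.
  have hW : IsOpen (U ∩ {β | c < ‖φ β‖}) :=
    hU.inter (isOpen_lt continuous_const φ.continuous.norm)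
  obtain ⟨ζ, hζ1, hζ0⟩ := exists_Cc_one_of_isCompact_subset_isOpen (isCompact_singleton (x := α))
    hW (Set.singleton_subset_iff.2 ⟨hα, hc⟩)
  have hpos : 0 < ‖Q.toX ζ‖ := Q.norm_toX_pos (α := α) (by simp [hζ1 α rfl])
  have h1 := h ζ fun β hβ => hζ0 β fun hβ' => hβ hβ'.1
  have hζ := h1.trans_lt (mul_lt_mul_of_pos_right hεc hpos)
  -- No sign is assumed on `ε`. For `c ≤ 0` the strict inequality `hζ` would make a norm negative.
  by_cases hc0 : c ≤ 0
  · exact absurd (norm_nonneg (Q.toX (mulCc φ ζ)))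
      (not_le.2 (hζ.trans_le (mul_nonpos_of_nonpos_of_nonneg hc0 hpos.le)))
  have h2 : ‖Q.toX ((c : ℂ) • ζ)‖ ≤ ‖Q.toX (mulCc φ ζ)‖ := by
    refine Q.norm_toX_mono fun β => ?_
    rw [CompactlySupportedContinuousMap.smul_apply, norm_smul, mulCc_apply, norm_mul,
      Complex.norm_real, Real.norm_of_nonneg (not_le.1 hc0).le]
    by_cases hβ : β ∈ U ∩ {β | c < ‖φ β‖}
    · exact mul_le_mul_of_nonneg_right hβ.2.le (norm_nonneg _)
    · simp [hζ0 β hβ]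
  rw [map_smul, norm_smul, Complex.norm_real, Real.norm_of_nonneg (not_le.1 hc0).le] at h2
  linarith

/-- If `σ(φ)` is compact then `φ` vanishes at infinity. -/
theorem tendsto_cocompact_of_sigmaL_mem_compacts {φ : E1 →ᵇ ℂ} (h : Q.sigmaL φ ∈ Q.compacts) :
    Tendsto φ (cocompact E1) (𝓝 0) := by
  have hS : ∀ (η : C_c(E1, ℂ)), ∀ ε > 0, ∀ᶠ U in (cocompact E1).smallSets,
      ∀ z ∈ {z | ∃ ζ : C_c(E1, ℂ), (∀ β ∉ U, ζ β = 0) ∧ z = Q.toX ζ},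
        ‖Q.innerX (Q.toX η) z‖ ≤ ε * ‖z‖ := by
    intro η ε hε
    -- Once `U` misses the support of `η`, the product of `star η` and `ζ` is zero, so the inner
    -- product vanishes exactly.
    refine eventually_smallSets.2
      ⟨(tsupport η)ᶜ, IsCompact.compl_mem_cocompact η.hasCompactSupport, ?_⟩
    rintro U hU z ⟨ζ, hζ, rfl⟩
    have h0 : Q.preInner η ζ = 0 := by
      ext v
      rw [preInner_apply]
      refine integral_eq_zero_of_ae (Eventually.of_forall fun α => ?_)
      by_cases hα : α ∈ U
      · simp [image_eq_zero_of_notMem_tsupport (hU hα)]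
      · simp [hζ α hα]
    rw [innerX_toX, h0, norm_zero]
    positivity
  rw [Metric.tendsto_nhds]
  intro ε hε
  obtain ⟨s, hs, hsmall⟩ := eventually_smallSets.1
    (Q.eventually_norm_le_of_mem_compacts hS h (ε / 2) (half_pos hε))
  obtain ⟨K, hK, hKs⟩ := mem_cocompact.1 hs
  filter_upwards [hK.compl_mem_cocompact] with α hα
  rw [dist_zero_right]
  refine lt_of_le_of_lt ?_ (half_lt_self hε)
  refine Q.norm_apply_le_of_norm_toX_mulCc_le hK.isClosed.isOpen_compl (fun ζ hζ => ?_) hα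
  rw [← sigma_toX]
  exact hsmall _ hKs _ ⟨ζ, hζ, rfl⟩

/-! ### Necessity: local injectivity of `r` -/

/-- The functional `⟨η, ·⟩` is small on functions with vanishing fibre integrals that are supported
near a given point. -/
theorem eventually_norm_preInner_le (α₀ : E1) (η : C_c(E1, ℂ)) {ε : ℝ} (hε : 0 < ε) :
    ∀ᶠ U in (𝓝 α₀).smallSets, ∀ ζ : C_c(E1, ℂ), (∀ β ∉ U, ζ β = 0) →
      (∀ v, ∫ β, ζ β ∂(Q.lam v) = 0) → ‖Q.preInner η ζ‖ ≤ ε * ‖Q.toX ζ‖ := by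
  obtain ⟨K, hK, hKα⟩ := exists_compact_mem_nhds α₀
  -- The fixed function `h` is 1 near `α₀`; pairing it with `|ζ|` (the function `a` below) bounds
  -- the fibrewise `L¹` norm of `ζ` by `‖h‖ ‖ζ‖`, by Cauchy–Schwarz.
  obtain ⟨h, h1, -⟩ := exists_Cc_one_of_isCompact_subset_isOpen hK isOpen_univ
    (Set.subset_univ K)
  set δ : ℝ := ε / (‖Q.toX h‖ + 1) with hδ
  have hδ0 : 0 < δ := by positivity
  have hη : {β | ‖η β - η α₀‖ < δ} ∈ 𝓝 α₀ := by
    refine (isOpen_lt (by fun_prop) continuous_const).mem_nhds ?_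
    simpa using hδ0
  refine eventually_smallSets.2 ⟨_, inter_mem hKα hη, fun U hU ζ hζ hint => ?_⟩
  let a : C_c(E1, ℂ) :=
    ⟨⟨fun β => (‖ζ β‖ : ℂ), by fun_prop⟩, ζ.hasCompactSupport.comp_left (g := fun z => (‖z‖ : ℂ))
      (by simp)⟩
  have ha : ‖Q.toX a‖ ≤ ‖Q.toX ζ‖ := Q.norm_toX_mono fun β => by
    change ‖(‖ζ β‖ : ℂ)‖ ≤ _
    simp
  refine C0_norm_le (by positivity) fun v => ?_
  have hζi := Q.integrable_Cc v ζ
  -- As `ζ` has integral zero on each fibre, the constant `η α₀` may be subtracted from `η`.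
  have h2 : Q.preInner η ζ v = ∫ β, star (η β - η α₀) * ζ β ∂(Q.lam v) := by
    simp only [star_sub, sub_mul]
    rw [integral_sub (Q.integrable_star_mul v η ζ) (hζi.const_mul _), integral_const_mul, hint v,
      mul_zero, sub_zero, preInner_apply]
  have h3 : ‖∫ β, star (η β - η α₀) * ζ β ∂(Q.lam v)‖ ≤ ∫ β, δ * ‖ζ β‖ ∂(Q.lam v) := by
    refine norm_integral_le_of_norm_le (hζi.norm.const_mul _) (Eventually.of_forall fun β => ?_)
    by_cases hβ : β ∈ U
    · rw [norm_mul, norm_star]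
      exact mul_le_mul_of_nonneg_right (le_of_lt (hU hβ).2) (norm_nonneg _)
    · simp [hζ β hβ]
  have h4 : Q.preInner h a v = ((∫ β, ‖ζ β‖ ∂(Q.lam v) : ℝ) : ℂ) := by
    rw [preInner_apply, ← integral_complex_ofReal]
    congr 1
    funext β
    change star (h β) * (‖ζ β‖ : ℂ) = _
    by_cases hβ : β ∈ U
    · simp [h1 β (hU hβ).1]
    · simp [hζ β hβ]
  have h5 : ∫ β, ‖ζ β‖ ∂(Q.lam v) ≤ ‖Q.toX h‖ * ‖Q.toX ζ‖ := by
    calc ∫ β, ‖ζ β‖ ∂(Q.lam v) = ‖Q.preInner h a v‖ := by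
          rw [h4, Complex.norm_real, Real.norm_of_nonneg (integral_nonneg fun _ => norm_nonneg _)]
      _ ≤ ‖Q.preInner h a‖ := C0_norm_apply_le _ v
      _ ≤ ‖Q.toX h‖ * ‖Q.toX a‖ := Q.norm_preInner_le h a
      _ ≤ ‖Q.toX h‖ * ‖Q.toX ζ‖ := by gcongr
  rw [h2]
  refine h3.trans ?_
  rw [integral_const_mul]
  calc δ * ∫ β, ‖ζ β‖ ∂(Q.lam v) ≤ δ * ((‖Q.toX h‖ + 1) * ‖Q.toX ζ‖) := by
        gcongr
        refine h5.trans ?_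
        gcongr
        linarith
    _ = ε * ‖Q.toX ζ‖ := by rw [hδ]; field_simp

/-- If `σ(φ)` is compact then `r` is injective near each point where `φ` does not vanish. -/
theorem exists_injOn_r_of_sigmaL_mem_compacts {φ : E1 →ᵇ ℂ} (h : Q.sigmaL φ ∈ Q.compacts)
    {α₀ : E1} (hα₀ : φ α₀ ≠ 0) : ∃ U : Set E1, IsOpen U ∧ α₀ ∈ U ∧ Set.InjOn Q.r U := by
  have hS : ∀ (η : C_c(E1, ℂ)), ∀ ε > 0, ∀ᶠ U in (𝓝 α₀).smallSets,
      ∀ z ∈ {z | ∃ ζ : C_c(E1, ℂ), (∀ β ∉ U, ζ β = 0) ∧ (∀ v, ∫ β, ζ β ∂(Q.lam v) = 0) ∧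
        z = Q.toX ζ}, ‖Q.innerX (Q.toX η) z‖ ≤ ε * ‖z‖ := by
    intro η ε hε
    filter_upwards [Q.eventually_norm_preInner_le α₀ η hε] with U hU z hz
    obtain ⟨ζ, hζ, hint, rfl⟩ := hz
    rw [innerX_toX]
    exact hU ζ hζ hint
  have hc : 0 < ‖φ α₀‖ := norm_pos_iff.2 hα₀
  -- The factor `1 / 3` lies below the lower bound `1 / 2` that comes from `|φ| > ‖φ α₀‖ / 2` on
  -- `U`; a nonzero test vector then gives the contradiction.
  obtain ⟨s, hs, hsmall⟩ := eventually_smallSets.1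
    (Q.eventually_norm_le_of_mem_compacts hS h (‖φ α₀‖ / 3) (by positivity))
  have hφ : {β | ‖φ α₀‖ / 2 < ‖φ β‖} ∈ 𝓝 α₀ :=
    (isOpen_lt continuous_const φ.continuous.norm).mem_nhds (half_lt_self hc)
  obtain ⟨U, hU, hUo, hαU⟩ := mem_nhds_iff.1 (inter_mem hs hφ)
  refine ⟨U, hUo, hαU, fun α hα β hβ hr => ?_⟩
  by_contra hne
  obtain ⟨A, B, hA, hB, hαA, hβB, hAB⟩ := t2_separation hne
  obtain ⟨f, hf1, hf0⟩ := exists_Cc_one_of_isCompact_subset_isOpen (isCompact_singleton (x := α))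
    (hUo.inter hA) (Set.singleton_subset_iff.2 ⟨hα, hαA⟩)
  obtain ⟨g, hg1, hg0⟩ := exists_Cc_one_of_isCompact_subset_isOpen (isCompact_singleton (x := β))
    (hUo.inter hB) (Set.singleton_subset_iff.2 ⟨hβ, hβB⟩)
  -- The bumps `|f|²` at `α` and `|g|²` at `β` are disjointly supported. Weighting each by the fibre
  -- integral of the other cancels the total on every fibre, while `ζ α = ⟨g, g⟩(r β) ≠ 0` because
  -- `r α = r β`.
  set ζ : C_c(E1, ℂ) := mulCc (pullback (Q.preInner g g) ⟨Q.r, Q.continuous_r⟩) (star f * f) -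
    mulCc (pullback (Q.preInner f f) ⟨Q.r, Q.continuous_r⟩) (star g * g) with hζ
  have hζ_apply : ∀ γ, ζ γ = Q.preInner g g (Q.r γ) * (star (f γ) * f γ) -
      Q.preInner f f (Q.r γ) * (star (g γ) * g γ) := fun γ => rfl
  have hζU : ∀ γ ∉ U, ζ γ = 0 := fun γ hγ => by
    rw [hζ_apply, hf0 γ fun h => hγ h.1, hg0 γ fun h => hγ h.1]
    simp
  have hint : ∀ v, ∫ γ, ζ γ ∂(Q.lam v) = 0 := fun v => by
    have h1 : ∫ γ, ζ γ ∂(Q.lam v) = Q.preInner g g v * Q.preInner f f v -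
        Q.preInner f f v * Q.preInner g g v := by
      rw [hζ]
      refine (integral_sub (Q.integrable_Cc v _) (Q.integrable_Cc v _)).trans ?_
      rw [integral_mulCc_pullback_r, integral_mulCc_pullback_r]
      rfl
    rw [h1, mul_comm, sub_self]
  have hζα : ζ α ≠ 0 := by
    have hgα : g α = 0 := hg0 α fun h => Set.disjoint_left.1 hAB hαA h.2
    rw [hζ_apply, hf1 α rfl, hgα, hr]
    simpa using Q.preInner_self_ne_zero (ξ := g) (α := β) (by simp [hg1 β rfl])
  have hpos := Q.norm_toX_pos hζα
  have h1 : ‖Q.toX (mulCc φ ζ)‖ ≤ ‖φ α₀‖ / 3 * ‖Q.toX ζ‖ := by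
    rw [← sigma_toX]
    exact hsmall U (fun γ hγ => (hU hγ).1) _ ⟨ζ, hζU, hint, rfl⟩
  have h2 : ‖Q.toX (((‖φ α₀‖ / 2 : ℝ) : ℂ) • ζ)‖ ≤ ‖Q.toX (mulCc φ ζ)‖ := by
    refine Q.norm_toX_mono fun γ => ?_
    rw [CompactlySupportedContinuousMap.smul_apply, norm_smul, mulCc_apply, norm_mul,
      Complex.norm_real, Real.norm_of_nonneg (by positivity)]
    by_cases hγ : γ ∈ U
    · exact mul_le_mul_of_nonneg_right (le_of_lt (hU hγ).2) (norm_nonneg _)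
    · simp [hζU γ hγ]
  rw [map_smul, norm_smul, Complex.norm_real, Real.norm_of_nonneg (by positivity)] at h2
  nlinarith [mul_pos hc hpos]

/-! ### Sufficiency: rank one pieces, partition of unity, approximation -/

/-- Multiplication by a compactly supported function is of rank one if `r` is injective on a
neighbourhood of its support. -/
theorem exists_sigma_eq_theta {ψ : E1 →ᵇ ℂ} (hψ : HasCompactSupport ψ) {U : Set E1}
    (hU : IsOpen U) (hψU : tsupport ψ ⊆ U) (hr : Set.InjOn Q.r U) :
    ∃ x y : Q.X, Q.sigma ψ = Q.theta x y := by
  obtain ⟨y, hy1, hy0⟩ := exists_Cc_one_of_isCompact_subset_isOpen hψ hU hψU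
  have hyy : ∀ α ∈ tsupport ψ, Q.preInner y y (Q.r α) ≠ 0 := fun α hα =>
    Q.preInner_self_ne_zero (by simp [hy1 α hα])
  -- The fibre through `α` meets `U` only in `α`, and `y` vanishes off `U`; only the value `z α`
  -- contributes.
  have hyz : ∀ α ∈ tsupport ψ, ∀ z : C_c(E1, ℂ),
      Q.preInner y z (Q.r α) = z α * Q.preInner y y (Q.r α) := by
    intro α hα z
    rw [preInner_apply, preInner_apply, ← integral_const_mul]
    refine integral_congr_ae ((Q.ae_lam_r_eq (Q.r α)).mono fun β hβ => ?_)
    by_cases hβU : β ∈ U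
    · obtain rfl := hr hβU (hψU hα) hβ
      simp [hy1 β hα]
    · simp [hy0 β hβU]
  -- By `hyz`, the left factor of the rank one operator must be `ψ / (⟨y, y⟩ ∘ r)`. The denominator
  -- may vanish off `tsupport ψ`, but there the quotient is locally zero.
  have hcont : Continuous fun α => ψ α / Q.preInner y y (Q.r α) := by
    refine continuous_iff_continuousAt.2 fun α => ?_
    by_cases hα : α ∈ tsupport ψ
    · exact ψ.continuous.continuousAt.div
        ((Q.preInner y y).continuous.comp Q.continuous_r).continuousAt (hyy α hα)
    · refine ContinuousAt.congr (f := fun _ => (0 : ℂ)) continuousAt_const ?_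
      filter_upwards [(isClosed_tsupport ψ).isOpen_compl.mem_nhds hα] with β hβ
      rw [image_eq_zero_of_notMem_tsupport hβ, zero_div]
  let x : C_c(E1, ℂ) := ⟨⟨_, hcont⟩, HasCompactSupport.intro hψ fun α hα => by
    change ψ α / _ = 0
    rw [image_eq_zero_of_notMem_tsupport hα, zero_div]⟩
  refine ⟨Q.toX x, Q.toX y, ?_⟩
  ext1 w
  refine Q.X_ext (f := Q.sigma ψ) (g := Q.theta (Q.toX x) (Q.toX y)) (Q.sigma ψ).continuous
    (Q.theta (Q.toX x) (Q.toX y)).continuous (fun z => ?_) w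
  rw [sigma_toX, theta_apply, innerX_toX]
  refine (Q.rightAction_toX _ _ _ fun α => ?_).symm
  change ψ α * z α = ψ α / Q.preInner y y (Q.r α) * Q.preInner y z (Q.r α)
  by_cases hα : α ∈ tsupport ψ
  · rw [hyz α hα z, mul_comm (z α), ← mul_assoc, div_mul_cancel₀ _ (hyy α hα)]
  · rw [image_eq_zero_of_notMem_tsupport hα, zero_mul, zero_div, zero_mul]

theorem sigmaL_add (φ ψ : E1 →ᵇ ℂ) : Q.sigmaL (φ + ψ) = Q.sigmaL φ + Q.sigmaL ψ :=
  Subtype.ext (Q.sigma_add φ ψ)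

theorem sigmaL_zero : Q.sigmaL 0 = 0 := by
  have h := Q.sigmaL_add 0 0
  rwa [add_zero, left_eq_add] at h

theorem sigmaL_sum {ι : Type*} (s : Finset ι) (ψ : ι → E1 →ᵇ ℂ) :
    Q.sigmaL (∑ i ∈ s, ψ i) = ∑ i ∈ s, Q.sigmaL (ψ i) :=
  map_sum (⟨⟨Q.sigmaL, Q.sigmaL_zero⟩, Q.sigmaL_add⟩ : (E1 →ᵇ ℂ) →+ Q.adjointable) ψ s

/-- `σ` is contractive, so uniform approximation of `φ` gives norm approximation of `σ(φ)`. -/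
theorem dist_sigmaL_le (φ ψ : E1 →ᵇ ℂ) : dist (Q.sigmaL φ) (Q.sigmaL ψ) ≤ ‖φ - ψ‖ := by
  have h : Q.sigma φ - Q.sigma ψ = Q.sigma (φ - ψ) := by
    rw [sub_eq_iff_eq_add, ← sigma_add, sub_add_cancel]
  change dist (Q.sigma φ) (Q.sigma ψ) ≤ _
  rw [dist_eq_norm, h]
  exact ContinuousLinearMap.opNorm_le_bound _ (norm_nonneg _) (Q.norm_sigma_apply_le _)

/-- `σ(ψ)` is compact if `ψ` is compactly supported and `r` is locally injective on its support. -/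
theorem sigmaL_mem_compacts_of_hasCompactSupport {ψ : E1 →ᵇ ℂ} (hψ : HasCompactSupport ψ)
    (h : ∀ α ∈ tsupport ψ, ∃ U : Set E1, IsOpen U ∧ α ∈ U ∧ Set.InjOn Q.r U) :
    Q.sigmaL ψ ∈ Q.compacts := by
  choose! U hUo hαU hinj using h
  obtain ⟨t, ht, htU⟩ := hψ.elim_nhds_subcover U fun α hα => (hUo α hα).mem_nhds (hαU α hα)
  let e := t.equivFin.symm
  obtain ⟨f, hfU, hf1, hf, -⟩ := exists_continuous_sum_one_of_isOpen_isCompact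
    (s := fun i => U (e i)) (fun i => hUo _ (ht _ (e i).2)) hψ (fun α hα => by
      obtain ⟨β, hβ, hαβ⟩ := Set.mem_iUnion₂.1 (htU hα)
      refine Set.mem_iUnion.2 ⟨t.equivFin ⟨β, hβ⟩, ?_⟩
      simpa [e] using hαβ)
  let p : Fin t.card → E1 →ᵇ ℂ := fun i =>
    BoundedContinuousFunction.ofNormedAddCommGroup (fun α => (f i α : ℂ) * ψ α) (by fun_prop) ‖ψ‖
      fun α => by
        rw [norm_mul, Complex.norm_real, Real.norm_of_nonneg (hf i α).1]
        exact (mul_le_of_le_one_left (norm_nonneg _) (hf i α).2).trans (ψ.norm_coe_le_norm α)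
  have hp : ψ = ∑ i, p i := by
    ext α
    rw [BoundedContinuousFunction.sum_apply]
    change ψ α = ∑ i, (f i α : ℂ) * ψ α
    rw [← Finset.sum_mul, ← Complex.ofReal_sum]
    by_cases hα : α ∈ tsupport ψ
    · have h1 : ∑ i, f i α = 1 := by simpa using hf1 hα
      rw [h1, Complex.ofReal_one, one_mul]
    · rw [image_eq_zero_of_notMem_tsupport hα, mul_zero]
  rw [hp, sigmaL_sum]
  refine Submodule.sum_mem _ fun i _ => Submodule.le_topologicalClosure _ (Submodule.subset_span ?_)
  -- The support of `p i` lies in that of `f i`, hence in a single open set where `r` is injective.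
  obtain ⟨x, y, hxy⟩ := Q.exists_sigma_eq_theta (ψ := p i) hψ.mul_left (hUo _ (ht _ (e i).2))
    ((tsupport_mul_subset_left.trans (closure_mono (Function.support_comp_subset
      Complex.ofReal_zero (f i)))).trans (hfU i)) (hinj _ (ht _ (e i).2))
  exact ⟨x, y, Subtype.ext hxy⟩

/-- `σ(φ)` is compact if `φ` vanishes at infinity and `r` is locally injective on its open
support. -/
theorem sigmaL_mem_compacts {φ : E1 →ᵇ ℂ} (hφ : Tendsto φ (cocompact E1) (𝓝 0))
    (h : ∀ α ∈ osupp φ, ∃ U : Set E1, IsOpen U ∧ α ∈ U ∧ Set.InjOn Q.r U) :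
    Q.sigmaL φ ∈ Q.compacts := by
  refine Metric.mem_closure_iff.2 fun ε hε => ?_
  have hK : IsCompact {α | ε / 2 ≤ ‖φ α‖} := by
    obtain ⟨K, hK, hKs⟩ := mem_cocompact.1 ((Metric.tendsto_nhds.1 hφ) (ε / 2) (half_pos hε))
    refine hK.of_isClosed_subset (isClosed_le continuous_const φ.continuous.norm) fun α hα => ?_
    by_contra hαK
    have h1 : dist (φ α) 0 < ε / 2 := hKs hαK
    rw [dist_zero_right] at h1
    exact absurd hα (not_le.2 h1)
  have hO : IsOpen (osupp φ) := isOpen_ne_fun φ.continuous continuous_const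
  have hKO : {α | ε / 2 ≤ ‖φ α‖} ⊆ osupp φ := fun α hα =>
    norm_pos_iff.1 ((half_pos hε).trans_le hα)
  -- Local injectivity is known only on `osupp φ`, not on its closure. The compact set `L` keeps the
  -- closed support of the cut-off function inside `osupp φ`.
  obtain ⟨L, hL, hKL, hLO⟩ := exists_compact_between hK hO hKO
  obtain ⟨f, hf1, hf0, -, hf⟩ := exists_continuous_one_zero_of_isCompact hK
    isOpen_interior.isClosed_compl (Set.disjoint_compl_right_iff_subset.2 hKL)
  let ψ : E1 →ᵇ ℂ :=
    BoundedContinuousFunction.ofNormedAddCommGroup (fun α => (f α : ℂ) * φ α) (by fun_prop) ‖φ‖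
      fun α => by
        rw [norm_mul, Complex.norm_real, Real.norm_of_nonneg (hf α).1]
        exact (mul_le_of_le_one_left (norm_nonneg _) (hf α).2).trans (φ.norm_coe_le_norm α)
  have hψL : tsupport ψ ⊆ L := by
    refine closure_minimal (fun α hα => ?_) hL.isClosed
    by_contra hαL
    refine hα ?_
    change (f α : ℂ) * φ α = 0
    have h0 : f α = 0 := hf0 fun h' => hαL (interior_subset h')
    rw [h0, Complex.ofReal_zero, zero_mul]
  have hmem : Q.sigmaL ψ ∈ Q.compacts := Q.sigmaL_mem_compacts_of_hasCompactSupport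
    (hL.of_isClosed_subset (isClosed_tsupport _) hψL) fun α hα => h α (hLO (hψL hα))
  have hdist : dist (Q.sigmaL φ) (Q.sigmaL ψ) ≤ ε / 2 := by
    refine (Q.dist_sigmaL_le φ ψ).trans
      ((BoundedContinuousFunction.norm_le (half_pos hε).le).2 fun α => ?_)
    change ‖φ α - (f α : ℂ) * φ α‖ ≤ _
    -- The cut-off changes `φ` only where `|φ| < ε / 2`, and by at most `|φ|`.
    by_cases hα : ε / 2 ≤ ‖φ α‖
    · have h1 : f α = 1 := hf1 hα
      rw [h1, Complex.ofReal_one, one_mul, sub_self, norm_zero]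
      exact (half_pos hε).le
    · have h2 : φ α - (f α : ℂ) * φ α = ((1 - f α : ℝ) : ℂ) * φ α := by
        push_cast
        ring
      rw [h2, norm_mul, Complex.norm_real, Real.norm_of_nonneg (sub_nonneg.2 (hf α).2)]
      exact (mul_le_of_le_one_left (norm_nonneg _) (by linarith [(hf α).1])).trans
        (not_le.1 hα).le
  obtain ⟨T, hT, hTd⟩ := Metric.mem_closure_iff.1 hmem (ε / 2) (half_pos hε)
  exact ⟨T, hT, (dist_triangle _ (Q.sigmaL ψ) _).trans_lt (by linarith)⟩

/-! ### Local homeomorphisms and the equivalence -/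

/-- The open map `r` restricts to a homeomorphism onto the image on some neighbourhood of `α` if and
only if it is injective near `α`. -/
theorem exists_isHomeomorph_iff (α : E1) :
    (∃ U ∈ 𝓝 α, IsHomeomorph (Set.imageFactorization Q.r U)) ↔
      ∃ U : Set E1, IsOpen U ∧ α ∈ U ∧ Set.InjOn Q.r U := by
  constructor
  · rintro ⟨U, hU, h⟩
    obtain ⟨V, hVU, hV, hα⟩ := mem_nhds_iff.1 hU
    exact ⟨V, hV, hα, (Set.imageFactorization_injective_iff.1 h.bijective.1).mono hVU⟩
  · rintro ⟨U, hU, hα, h⟩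
    refine ⟨U, hU.mem_nhds hα, (Q.continuous_r.comp continuous_subtype_val).subtype_mk _, ?_,
      h.imageFactorization_injective, Set.imageFactorization_surjective⟩
    intro V hV
    -- As `U` is open, a relatively open subset of `U` is open in `E1`; its image is open in `E0`
    -- and restricts to an open subset of `r '' U`.
    refine ⟨Q.r '' (Subtype.val '' V), Q.isOpenMap_r _ (hU.isOpenMap_subtype_val V hV), ?_⟩
    ext ⟨v, hv⟩
    constructor
    · rintro ⟨_, ⟨β, hβ, rfl⟩, rfl⟩
      exact ⟨β, hβ, rfl⟩
    · rintro ⟨β, hβ, hβv⟩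
      exact ⟨β, ⟨β, hβ, rfl⟩, congrArg Subtype.val hβv⟩

theorem sigmaL_mem_compacts_iff (φ : E1 →ᵇ ℂ) :
    Q.sigmaL φ ∈ Q.compacts ↔ (∃ g : C₀(E1, ℂ), ⇑g = ⇑φ) ∧
      ∀ α ∈ osupp ⇑φ, ∃ U ∈ 𝓝 α, IsHomeomorph (Set.imageFactorization Q.r U) := by
  simp only [exists_isHomeomorph_iff]
  constructor
  · intro h
    exact ⟨⟨⟨φ.toContinuousMap, Q.tendsto_cocompact_of_sigmaL_mem_compacts h⟩, rfl⟩,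
      fun α hα => Q.exists_injOn_r_of_sigmaL_mem_compacts h hα⟩
  · rintro ⟨⟨g, hg⟩, h⟩
    exact Q.sigmaL_mem_compacts (hg ▸ zero_at_infty g) h

end Compacts

end TopologicalQuiver

theorem mainTheorem7 {E0 E1 : Type*}
    [TopologicalSpace E0] [T2Space E0] [LocallyCompactSpace E0] [SecondCountableTopology E0]
    [TopologicalSpace E1] [T2Space E1] [LocallyCompactSpace E1] [SecondCountableTopology E1]
    [MeasurableSpace E1] [BorelSpace E1]
    (Q : TopologicalQuiver E0 E1) :
    (∀ φ : E1 →ᵇ ℂ,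
      Q.sigmaL φ ∈ Q.compacts ↔
        (∃ g : C₀(E1, ℂ), ⇑g = ⇑φ) ∧
        ∀ α ∈ TopologicalQuiver.osupp ⇑φ,
          ∃ U ∈ 𝓝 α, IsHomeomorph (Set.imageFactorization Q.r U)) ∧
    (∀ f : C₀(E0, ℂ),
      Q.leftActionL f ∈ Q.compacts ↔
        (∃ g : C₀(E1, ℂ), ⇑g = ⇑f ∘ Q.s) ∧
        ∀ α ∈ TopologicalQuiver.osupp (⇑f ∘ Q.s),
          ∃ U ∈ 𝓝 α, IsHomeomorph (Set.imageFactorization Q.r U)) := by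
  -- `leftActionL f` unfolds to `sigmaL` of the pullback of `f` along `s`, so (b) is an instance of
  -- (a).
  exact ⟨Q.sigmaL_mem_compacts_iff, fun f => Q.sigmaL_mem_compacts_iff _⟩
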